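/- Let $\mathcal{O}_X$ be a Noetherian commutative local Gorenstein ring, and let $I_D \subset \mathcal{O}_X$ be an ideal of codimension (height) one such that $\mathcal{O}_X/I_D$ is Gorenstein. Let $z \in I_D$ be an $\mathcal{O}_X$-regular element (a non-zero-divisor) with $(z) \neq I_D$. Define the residual ideal of $I_D$ with respect to $z$ by \[ I_r = \{\, f(z) : f \in \operatorname{Hom}_{\mathcal{O}_X}(I_D, \mathcal{O}_X) \,\} \subset \mathcal{O}_X . \] Then $I_r$ has codimension (height) one in $\mathcal{O}_X$. Moreover, for every $f \in \operatorname{Hom}_{\mathcal{O}_X}(I_D,\mathcal{O}_X)$, the sequence $z, f(z)$ is not an $\mathcal{O}_X$-regular sequence. -/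

import Mathlib

universe u

/-- A Gorenstein local ring: a Noetherian local ring `R` having an `R`-regular sequence `rs` such
that `R ⧸ (rs)` is zero-dimensional (Artinian) and injective as a module over itself. Thus `R` is
Cohen-Macaulay, and its reduction modulo a maximal regular sequence is a zero-dimensional
Gorenstein (that is, self-injective Artinian local) ring. -/
structure IsGorensteinLocalRing (R : Type u) [CommRing R] : Prop where
  isLocalRing : IsLocalRing R
  isNoetherianRing : IsNoetherianRing R
  exists_regular_sequence : ∃ rs : List R, RingTheory.Sequence.IsRegular R rs ∧
    IsArtinianRing (R ⧸ Ideal.ofList rs) ∧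
    Module.Injective (R ⧸ Ideal.ofList rs) (R ⧸ Ideal.ofList rs)

/-- The residual ideal of `I` with respect to `z ∈ I`: the set of all values `f z`, where `f` runs
over the `R`-linear maps `I → R`. -/
def residualIdeal {R : Type u} [CommRing R] (I : Ideal R) (z : I) : Ideal R where
  carrier := {a | ∃ f : I →ₗ[R] R, f z = a}
  add_mem' := by
    rintro _ _ ⟨f, rfl⟩ ⟨g, rfl⟩
    exact ⟨f + g, rfl⟩
  zero_mem' := ⟨0, rfl⟩
  smul_mem' := by
    rintro c _ ⟨f, rfl⟩
    exact ⟨c • f, rfl⟩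

/-! Pick `y ∈ I` outside `(z)`. Since `y * f z = z * f y`, every `f z` kills the nonzero class of
`y` in `R ⧸ z R`, so `z, f z` is never regular. The residual ideal thus lies in an associated prime
of `R ⧸ z R`, which has height at most one because `R` is Cohen-Macaulay
(`IsGorensteinLocalRing.height_le_one_of_isAssociatedPrime`). It contains `z`, so its height is at
least one. -/

open RingTheory.Sequence IsLocalRing CategoryTheory Abelian Limits Pointwise in
/-- Dividing by a regular element of the maximal ideal lowers the length of the regular sequences
that exist on a finite module over a Noetherian local ring by at most one. -/
theorem exists_isRegular_quotSMulTop {R : Type u} [CommRing R] [IsLocalRing R] [IsNoetherianRing R]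
    (M : Type u) [AddCommGroup M] [Module R M] [Module.Finite R M] {rs : List R} {n : ℕ}
    (hrs : IsRegular M rs) (hmem : ∀ r ∈ rs, r ∈ maximalIdeal R) (hlen : rs.length = n + 1)
    {z : R} (hz : z ∈ maximalIdeal R) (hzM : IsSMulRegular M z) :
    ∃ ss : List R, ss.length = n ∧ (∀ r ∈ ss, r ∈ maximalIdeal R) ∧
      IsRegular (QuotSMulTop z M) ss := by
  -- Rees's criterion: Ext from the residue field detects depth, so `rs` need not begin with `z`.
  have rees (N : Type u) [AddCommGroup N] [Module R N] [Module.Finite R N] [Nontrivial N] (k : ℕ) :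
      (∀ i < k, Subsingleton (Ext (ModuleCat.of R (Shrink.{u} (R ⧸ maximalIdeal R)))
        (ModuleCat.of R N) i)) ↔
      ∃ ss : List R, ss.length = k ∧ (∀ r ∈ ss, r ∈ maximalIdeal R) ∧ IsRegular N ss :=
    (ModuleCat.exists_isRegular_tfae (maximalIdeal R) k (ModuleCat.of R N)
      (Submodule.top_ne_ideal_smul_of_le_jacobson_annihilator
        (maximalIdeal_le_jacobson _)).symm.lt_top).out 1 3
  have := hrs.nontrivial
  have := nontrivial_quotSMulTop_of_mem_maximalIdeal M hz
  have hext := (rees M (n + 1)).2 ⟨rs, hlen, hmem, hrs⟩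
  refine (rees (QuotSMulTop z M) n).1 fun i hi ↦ ?_
  -- In the long exact sequence of multiplication by `z`, Ext of the quotient in degree `i` sits
  -- between Ext of `M` in degrees `i` and `i + 1`.
  have zero1 := AddCommGrpCat.isZero_of_iff_subsingleton.mpr (hext i (by omega))
  have zero2 := AddCommGrpCat.isZero_of_iff_subsingleton.mpr (hext (i + 1) (by omega))
  exact AddCommGrpCat.subsingleton_of_isZero <| ShortComplex.Exact.isZero_of_both_zeros
    ((Ext.covariant_sequence_exact₃' _
      (IsSMulRegular.smulShortComplex_shortExact (M := ModuleCat.of R M) hzM)) i (i + 1) rfl)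
    (zero1.eq_zero_of_src _) (zero2.eq_zero_of_tgt _)

open IsLocalRing Pointwise in
/-- An associated prime of `M` is contained, together with any `M`-regular element `x` of the
maximal ideal, in an associated prime of `M ⧸ x M`. -/
theorem IsAssociatedPrime.exists_le_quotSMulTop {R M : Type*} [CommRing R] [IsLocalRing R]
    [IsNoetherianRing R] [AddCommGroup M] [Module R M] [Module.Finite R M] {P : Ideal R}
    (hP : IsAssociatedPrime P M) {x : R} (hx : x ∈ maximalIdeal R) (hxM : IsSMulRegular M x) :
    ∃ Q : Ideal R, IsAssociatedPrime Q (QuotSMulTop x M) ∧ P ≤ Q ∧ x ∈ Q := by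
  obtain ⟨-, u₀, hu₀⟩ := isAssociatedPrime_iff.1 hP
  have hne : u₀ ≠ 0 := by
    rintro rfl
    exact hP.isPrime.ne_top (by rw [hu₀]; ext; simp [Submodule.mem_colon_singleton])
  let N : Submodule R M := Submodule.torsionBySet R M P
  have hN {u : M} : u ∈ N ↔ ∀ p ∈ P, p • u = 0 := by simp [N, Submodule.mem_torsionBySet_iff]
  have hu₀N : u₀ ∈ N := hN.2 fun p hp ↦ by
    rw [hu₀, Submodule.mem_colon_singleton] at hp
    simpa using hp
  obtain ⟨u, huN, hux⟩ : ∃ u ∈ N, u ∉ x • (⊤ : Submodule R M) := by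
    by_contra! h
    -- If `x • v` is killed by `P`, so is `v`, as `x` is regular; hence `N ⊆ x M` would force `N = x
    -- N`, and Nakayama gives `N = 0`.
    have hle : N ≤ maximalIdeal R • N := fun u hu ↦ by
      obtain ⟨v, -, rfl⟩ := (Submodule.mem_smul_pointwise_iff_exists _ _ _).1 (h u hu)
      refine Submodule.smul_mem_smul hx (hN.2 fun p hp ↦ hxM ?_)
      have := hN.1 hu p hp
      simpa [smul_comm x p] using this
    have hbot := Submodule.eq_bot_of_le_smul_of_le_jacobson_bot (maximalIdeal R) N
      (IsNoetherian.noetherian N) hle (maximalIdeal_le_jacobson _)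
    exact hne (by simpa [hbot] using hu₀N)
  obtain ⟨Q, hQ, hle⟩ := exists_le_isAssociatedPrime_of_isNoetherianRing R
    (Submodule.Quotient.mk u : QuotSMulTop x M)
    (fun h ↦ hux ((Submodule.Quotient.mk_eq_zero _).1 h))
  refine ⟨Q, hQ, fun p hp ↦ hle ?_, hle ?_⟩
  · rw [Submodule.mem_colon_singleton, ← Submodule.Quotient.mk_smul, hN.1 huN p hp]
    simp
  · rw [Submodule.mem_colon_singleton, ← Submodule.Quotient.mk_smul, Submodule.mem_bot,
      Submodule.Quotient.mk_eq_zero]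
    exact Submodule.smul_mem_pointwise_smul _ _ _ trivial

/-- The elements of an associated prime of `M` are not regular on `M`. -/
theorem IsAssociatedPrime.not_isSMulRegular {R M : Type*} [CommRing R] [IsNoetherianRing R]
    [AddCommGroup M] [Module R M] {P : Ideal R} (hP : IsAssociatedPrime P M) {x : R}
    (hx : x ∈ P) : ¬ IsSMulRegular M x := by
  have : x ∈ ⋃ p ∈ associatedPrimes R M, (p : Set R) := Set.mem_biUnion hP hx
  rwa [biUnion_associatedPrimes_eq_compl_regular] at this

open IsLocalRing RingTheory.Sequence in
/-- If a finite module over a Noetherian local ring carries a regular sequence of length `n`, each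
of its associated primes is at least `n` steps below the maximal ideal. -/
theorem IsAssociatedPrime.height_add_length_le {R : Type*} [CommRing R] [IsLocalRing R]
    [IsNoetherianRing R] (rs : List R) (hmem : ∀ r ∈ rs, r ∈ maximalIdeal R) {M : Type*}
    [AddCommGroup M] [Module R M] [Module.Finite R M] (hrs : IsWeaklyRegular M rs) {P : Ideal R}
    (hP : IsAssociatedPrime P M) : P.height + rs.length ≤ (maximalIdeal R).height := by
  induction rs generalizing M P with
  | nil => simpa using Ideal.height_mono (le_maximalIdeal hP.isPrime.ne_top)
  | cons x rs ih =>
    rw [isWeaklyRegular_cons_iff] at hrs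
    obtain ⟨Q, hQ, hPQ, hxQ⟩ := hP.exists_le_quotSMulTop (hmem x (by simp)) hrs.1
    have := hP.isPrime
    have := hQ.isPrime
    have hlt : P < Q := lt_of_le_of_ne hPQ fun h ↦ hP.not_isSMulRegular (h ▸ hxQ) hrs.1
    calc P.height + (x :: rs).length = P.height + 1 + rs.length := by
          push_cast [List.length_cons]; ring
      _ ≤ Q.height + rs.length := by
          gcongr; exact Ideal.height_add_one_le_of_lt_of_isPrime hlt
      _ ≤ _ := ih (fun r hr ↦ hmem r (by simp [hr])) hrs.2 hQ

open IsLocalRing in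
/-- If the quotient of a Noetherian local ring by a proper ideal generated by `n` elements is
Artinian, the maximal ideal has height at most `n`. -/
theorem height_maximalIdeal_le_length {R : Type*} [CommRing R] [IsLocalRing R]
    [IsNoetherianRing R] (rs : List R) (hne : Ideal.ofList rs ≠ ⊤)
    [IsArtinianRing (R ⧸ Ideal.ofList rs)] : (maximalIdeal R).height ≤ rs.length := by
  have hmin : maximalIdeal R ∈ (Ideal.ofList rs).minimalPrimes := by
    obtain ⟨p, hp⟩ := Ideal.nonempty_minimalPrimes hne
    have := hp.1.1
    -- An Artinian domain is a field, so a prime minimal over `(rs)` is maximal; Krull's height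
    -- theorem then applies.
    have hart : IsArtinianRing (R ⧸ p) :=
      (Ideal.Quotient.factor_surjective hp.1.2).isArtinianRing
    have hmax : p.IsMaximal := Ideal.Quotient.maximal_of_isField _
      (IsArtinianRing.isField_of_isDomain (R ⧸ p))
    rwa [← eq_maximalIdeal hmax]
  classical
  refine (Ideal.height_le_card_of_mem_minimalPrimes_span_finset (s := rs.toFinset) ?_).trans
    (by exact_mod_cast rs.toFinset_card_le)
  simpa [Ideal.ofList] using hmin

open IsLocalRing RingTheory.Sequence Pointwise in
/-- Unmixedness of a regular principal ideal `(z)` of a Cohen-Macaulay local ring: the associated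
primes of `R ⧸ z R` have height at most one. -/
theorem IsGorensteinLocalRing.height_le_one_of_isAssociatedPrime {R : Type u} [CommRing R]
    (hR : IsGorensteinLocalRing R) {z : R} (hz : IsSMulRegular R z) {P : Ideal R}
    (hP : IsAssociatedPrime P (QuotSMulTop z R)) : P.height ≤ 1 := by
  have := hR.isLocalRing
  have := hR.isNoetherianRing
  obtain ⟨rs, hrs, hart, -⟩ := hR.exists_regular_sequence
  have hne : Ideal.ofList rs ≠ ⊤ := fun h ↦ hrs.top_ne_smul (by simp [h])
  have hdim := height_maximalIdeal_le_length rs hne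
  have hmem : ∀ r ∈ rs, r ∈ maximalIdeal R := fun r hr ↦
    le_maximalIdeal hne (Ideal.subset_span hr)
  have hPm := le_maximalIdeal hP.isPrime.ne_top
  have hzP : z ∈ P := by
    obtain ⟨-, u, rfl⟩ := isAssociatedPrime_iff.1 hP
    obtain ⟨u, rfl⟩ := Submodule.Quotient.mk_surjective _ u
    rw [Submodule.mem_colon_singleton, ← Submodule.Quotient.mk_smul, Submodule.mem_bot,
      Submodule.Quotient.mk_eq_zero]
    exact Submodule.smul_mem_pointwise_smul _ _ _ trivial
  rcases h : rs.length with _ | n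
  · rw [h] at hdim
    exact (Ideal.height_mono hPm).trans (hdim.trans (by simp))
  · obtain ⟨ss, hlen, hss, hreg⟩ := exists_isRegular_quotSMulTop R hrs hmem h (hPm hzP) hz
    have hle := (hP.height_add_length_le ss hss hreg.toIsWeaklyRegular).trans hdim
    -- The bound is `P.height + n ≤ 1 + n`; `n` is finite and cancels in `ℕ∞`.
    rw [hlen, h, Nat.cast_add, Nat.cast_one, add_comm (n : ℕ∞) 1] at hle
    exact (ENat.add_le_add_iff_right (ENat.natCast_ne_top n)).1 hle

/-- Both sides are `f (x * y)`. -/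
theorem mul_apply_comm_of_mem {R : Type u} [CommRing R] {I : Ideal R} (f : I →ₗ[R] R) (x y : I) :
    (x : R) * f y = y * f x := by
  rw [← smul_eq_mul, ← smul_eq_mul, ← map_smul, ← map_smul]
  congr 1
  ext
  simp [mul_comm]

open Pointwise in
theorem mainTheorem7 {R : Type u} [CommRing R] (hR : IsGorensteinLocalRing R)
    (I : Ideal R) (hI : I.height = 1) (hRI : IsGorensteinLocalRing (R ⧸ I))
    (z : I) (hz : (z : R) ∈ nonZeroDivisors R) (hzI : Ideal.span {(z : R)} ≠ I) :
    (residualIdeal I z).height = 1 ∧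
      ∀ f : I →ₗ[R] R, ¬ RingTheory.Sequence.IsRegular R [(z : R), f z] := by
  have := hR.isLocalRing
  have := hR.isNoetherianRing
  have hzreg : IsSMulRegular R (z : R) :=
    IsSMulRegular.of_right_eq_zero_of_smul fun x hx ↦
      (mem_nonZeroDivisors_iff.1 hz).1 x (by simpa using hx)
  obtain ⟨y, hyI, hyz⟩ : ∃ y ∈ I, y ∉ Ideal.span {(z : R)} := by
    by_contra! h
    exact hzI (le_antisymm ((Ideal.span_singleton_le_iff_mem I).2 z.2) h)
  let u : QuotSMulTop (z : R) R := Submodule.Quotient.mk y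
  have hu : u ≠ 0 := fun h ↦ by
    obtain ⟨b, -, hb⟩ := (Submodule.mem_smul_pointwise_iff_exists _ _ _).1
      ((Submodule.Quotient.mk_eq_zero _).1 h)
    exact hyz (Ideal.mem_span_singleton'.2 ⟨b, by rw [← hb, smul_eq_mul, mul_comm]⟩)
  have hfu (f : I →ₗ[R] R) : f z • u = 0 := by
    rw [← Submodule.Quotient.mk_smul, Submodule.Quotient.mk_eq_zero, smul_eq_mul, mul_comm,
      mul_apply_comm_of_mem f ⟨y, hyI⟩ z]
    exact Submodule.smul_mem_pointwise_smul _ _ _ trivial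
  refine ⟨le_antisymm ?_ ?_, fun f hf ↦ ?_⟩
  · obtain ⟨P, hP, hle⟩ := exists_le_isAssociatedPrime_of_isNoetherianRing R u hu
    refine (Ideal.height_mono ?_).trans (hR.height_le_one_of_isAssociatedPrime hzreg hP)
    rintro _ ⟨f, rfl⟩
    exact hle (by rw [Submodule.mem_colon_singleton, hfu f]; simp)
  · refine (Ideal.one_le_height_span_singleton_of_mem_nonZeroDivisors hz).trans
      (Ideal.height_mono ?_)
    rw [Ideal.span_singleton_le_iff_mem]
    exact ⟨I.subtype, rfl⟩
  · have hreg := hf.toIsWeaklyRegular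
    rw [RingTheory.Sequence.isWeaklyRegular_cons_iff,
      RingTheory.Sequence.isWeaklyRegular_singleton_iff] at hreg
    exact hu (hreg.2.right_eq_zero_of_smul (hfu f))
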